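/- Let $G=(V,E)$ be a finite undirected graph with edge lengths $d_e\ge 0$ ($e\in E$) and let $\mathfrak T\subseteq V\times V$ be a set of terminal pairs. A feasible Steiner forest is a cycle-free edge set $F\subseteq E$ that connects the two vertices of every pair in $\mathfrak T$. For $F\subseteq E$, let $V[F]$ be the set of endpoints of edges of $F$ and let $d(F)=\sum_{e\in F}d_e$. The width of a connected component of $(V[F],F)$ is the maximum, over all terminal pairs with both vertices in that component, of their shortest-path distance in $(G,d)$ (and $0$ if there is no such pair). The total width $w(F)$ is the sum of the widths of all connected components of $(V[F],F)$, and $\phi(F)=d(F)+w(F)$. Let $A$ and $F$ be feasible Steiner forests with $V[A]=V[F]$. An edge/set swap of $A$ with respect to $F$ adds to $A$ an edge $f\in F$ that closes a cycle with $A$ and removes a set $S\subseteq A$ of edges of this cycle such that $(A\cup\{f\})\setminus S$ is again a feasible Steiner forest; it is an edge/edge swap if $|S|=1$. Assume that $A$ is a tree and that $A$ is edge/edge and edge/set swap-optimal with respect to $F$ and $\phi$, that is, no edge/edge swap and no edge/set swap of $A$ with respect to $F$ leads to a forest with strictly smaller $\phi$. Let $A'$ be obtained from $A$ by dropping all inessential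 edges, i.e. all $e\in A$ such that $A\setminus\{e\}$ still connects every terminal pair. Then $$d(A')\le 10.5\cdot d(F)+w(F)\le 11.5\cdot d(F).$$ -/

import Mathlib

namespace SteinerForest

noncomputable section

variable {V : Type*}

/-- The vertex set `V[F]` of the edge set `F`: all endpoints of edges of `F`. -/
def verts (F : Finset (Sym2 V)) : Set V := {v | ∃ e ∈ F, v ∈ e}

/-- The subgraph with edge set `F`, viewed as a graph on all of `V` (vertices outside `V[F]` are
isolated). -/
abbrev graphOf (F : Finset (Sym2 V)) : SimpleGraph V := SimpleGraph.fromEdgeSet (F : Set (Sym2 V))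

/-- The set of edges `F` connects every terminal pair in `T`. -/
def Feasible (T : Set (V × V)) (F : Finset (Sym2 V)) : Prop :=
  ∀ p ∈ T, (graphOf F).Reachable p.1 p.2

/-- `F` is a feasible Steiner forest for the graph `G` and the terminal pairs `T`: a cycle-free set
of edges of `G` that connects every terminal pair. -/
structure IsSteinerForest (G : SimpleGraph V) (T : Set (V × V)) (F : Finset (Sym2 V)) : Prop where
  subset : (F : Set (Sym2 V)) ⊆ G.edgeSet
  acyclic : (graphOf F).IsAcyclic
  feasible : Feasible T F

/-- The edge-induced graph `(V[F], F)` is a tree. -/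
structure IsTreeOn (F : Finset (Sym2 V)) : Prop where
  acyclic : (graphOf F).IsAcyclic
  connected : ∀ u ∈ verts F, ∀ v ∈ verts F, (graphOf F).Reachable u v

/-- The total length `d(F)`. -/
def cost (d : Sym2 V → ℝ) (F : Finset (Sym2 V)) : ℝ := ∑ e ∈ F, d e

/-- The shortest-path distance between `u` and `v` in the graph `G` with edge lengths `d`. It is
only ever used for vertices that are connected in `G`. -/
def pathDist (G : SimpleGraph V) (d : Sym2 V → ℝ) (u v : V) : ℝ :=
  sInf {r : ℝ | ∃ p : G.Walk u v, p.IsPath ∧ r = (p.edges.map d).sum}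

/-- The width of a connected part with vertex set `W`: the maximal distance (in `G`) of a terminal
pair with both ends in `W`. It is `0` if there is no such pair. -/
def width (G : SimpleGraph V) (d : Sym2 V → ℝ) (T : Set (V × V)) (W : Set V) : ℝ :=
  sSup {r : ℝ | ∃ p ∈ T, p.1 ∈ W ∧ p.2 ∈ W ∧ r = pathDist G d p.1 p.2}

/-- The total width `w(F)`: the sum of the widths of the connected components of `F`. Vertices
outside `V[F]` form one-vertex components of `graphOf F`; their width is `0`. -/
def totalWidth (G : SimpleGraph V) (d : Sym2 V → ℝ) (T : Set (V × V)) (F : Finset (Sym2 V)) : ℝ :=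
  ∑ᶠ C : (graphOf F).ConnectedComponent, width G d T C.supp

/-- The potential `φ(F) = d(F) + w(F)`. -/
def potential (G : SimpleGraph V) (d : Sym2 V → ℝ) (T : Set (V × V)) (F : Finset (Sym2 V)) : ℝ :=
  cost d F + totalWidth G d T F

/-- `B` arises from `A` by an edge/set swap with an edge of `F`: add an edge `f ∈ F` that closes a
cycle with `A` and remove a set `S ⊆ A` of edges of this cycle, such that the result is again a
feasible Steiner forest. -/
def EdgeSetSwap [DecidableEq V] (G : SimpleGraph V) (T : Set (V × V))
    (F A B : Finset (Sym2 V)) : Prop :=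
  ∃ f ∈ F, ∃ S ⊆ A, ∃ (u : V) (c : (graphOf (insert f A)).Walk u u),
    c.IsCycle ∧ (∀ e ∈ S, e ∈ c.edges) ∧ B = insert f A \ S ∧ IsSteinerForest G T B

/-- `B` arises from `A` by an edge/edge swap with an edge of `F`: add an edge `f ∈ F` that closes a
cycle with `A` and remove an edge `e ∈ A` of this cycle, such that the result is again a feasible
Steiner forest. -/
def EdgeEdgeSwap [DecidableEq V] (G : SimpleGraph V) (T : Set (V × V))
    (F A B : Finset (Sym2 V)) : Prop :=
  ∃ f ∈ F, ∃ e ∈ A, ∃ (u : V) (c : (graphOf (insert f A)).Walk u u),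
    c.IsCycle ∧ e ∈ c.edges ∧ B = (insert f A).erase e ∧ IsSteinerForest G T B

/-- `A` is optimal with respect to the edges of `F` and the potential `φ` under edge/edge swaps: no
such swap is improving. -/
def EdgeEdgeSwapOptimal [DecidableEq V] (G : SimpleGraph V) (d : Sym2 V → ℝ) (T : Set (V × V))
    (F A : Finset (Sym2 V)) : Prop :=
  ∀ B, EdgeEdgeSwap G T F A B → ¬ potential G d T B < potential G d T A

/-- `A` is optimal with respect to the edges of `F` and the potential `φ` under edge/set swaps: no
such swap is improving. -/
def EdgeSetSwapOptimal [DecidableEq V] (G : SimpleGraph V) (d : Sym2 V → ℝ) (T : Set (V × V))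
    (F A : Finset (Sym2 V)) : Prop :=
  ∀ B, EdgeSetSwap G T F A B → ¬ potential G d T B < potential G d T A

/-- An edge `e` of `A` is inessential if `A` without `e` still connects all terminal pairs. -/
def Inessential [DecidableEq V] (T : Set (V × V)) (A : Finset (Sym2 V)) (e : Sym2 V) : Prop :=
  Feasible T (A.erase e)

open Classical in
/-- The edge set obtained from `A` by dropping all inessential edges. -/
def dropInessential [DecidableEq V] (T : Set (V × V)) (A : Finset (Sym2 V)) : Finset (Sym2 V) :=
  A.filter fun e => ¬ Inessential T A e

end

end SteinerForest

/-!
The proof charges the edges of the tree `A` to the edges of `F` and to the components of `F`; it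
yields the bound `8 * d(F) + w(F)`.

**Classes.** Removing an edge `e` of the tree `A` splits `V[A]` into two sides; let `cut e` be the
set of edges of `F` running between them. If `cut e = ∅`, then `e` is inessential. The other edges
are grouped into classes `S` of equal cut. Let `f` lie in the cut of `S`. If `f ∈ A`, then `S =
{f}`. Otherwise all of `S` lies on the fundamental cycle of `f`, and for each non-empty `S₁ ⊆ S` no
edge of `F` joins different components of `(A ∪ {f}) \ S₁`. So this is a feasible swap. In terms of
sides only, these components are the parts of `S₁` (`SamePart`): two vertices are in the same part
if they are separated by none or by all of `S₁`. The only fact about trees used in the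
combinatorial part is that sides do not cross (`IsSplitSystem`).

**Cost of a class.** Rank the components of `F` by width and let `K₀` be the best one. The width of
a part is that of its best component, its leader, so swap-optimality yields that `d(S₁)` is at most
`d(f)` plus the widths of the leaders of `S₁` other than `K₀` (`cost_le_of_edgeSetSwapOptimal`).
Let `K₁` be the second best leader of `S`. The parts of `K₀` and `K₁` cut the cycle of `f` into two
arcs; applying the bound to the edges of `S` on each of them gives `d(S) ≤ 2 d(f) + ∑ w(K)` over
the leaders `K ≠ K₀, K₁` of `S`, its losers (`sum_le_of_swaps`).

**Summing up.** A component of `F` is a loser of at most one class (`disjoint_losers`), so the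
widths sum up to at most `w(F)`. The cuts of `k` classes contain at least `k / 4` edges: sides form
a laminar family on the ends of these edges, and a laminar family of non-empty subsets of an
`n`-set has at most `2 n` members (`card_cuts_le`). By Hall's theorem each class can choose an edge
`f` of its cut such that no edge is chosen more than four times (`exists_assignment`), so the terms
`2 d(f)` sum up to at most `8 d(F)`.
-/

namespace SteinerForest

/-! ### Laminar families -/

/-- Removing a point `x` from a laminar family of non-empty sets loses at most two members: `{x}`
and one of at most one pair of sets that differ by `x` only. -/
theorem card_le_two_mul_of_laminar {β : Type*} [DecidableEq β] (R : Finset β)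
    (L : Finset (Finset β)) (hsub : ∀ X ∈ L, X ⊆ R) (hne : ∀ X ∈ L, X.Nonempty)
    (hlam : ∀ X ∈ L, ∀ Y ∈ L, Disjoint X Y ∨ X ⊆ Y ∨ Y ⊆ X) : L.card ≤ 2 * R.card := by
  induction R using Finset.induction_on generalizing L with
  | empty =>
    have : L = ∅ := Finset.eq_empty_of_forall_notMem fun X hX =>
      (hne X hX).ne_empty (Finset.subset_empty.1 (hsub X hX))
    simp [this]
  | insert x R hx ih =>
    set L₀ := L.erase {x} with hL₀
    set M := L₀.filter fun X => x ∈ X ∧ X.erase x ∈ L₀ with hM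
    have h0 : L.card ≤ L₀.card + 1 := by
      have := Finset.pred_card_le_card_erase (s := L) (a := {x})
      rw [hL₀]
      omega
    -- At most one pair of members of `L₀` differs by `x` only: two such pairs would cross.
    have h1 : M.card ≤ 1 := by
      refine Finset.card_le_one.2 fun X hX Y hY => ?_
      simp only [hM, hL₀, Finset.mem_filter, Finset.mem_erase] at hX hY
      obtain ⟨⟨-, hXL⟩, hxX, -, hXL'⟩ := hX
      obtain ⟨⟨-, hYL⟩, hxY, -, hYL'⟩ := hY
      obtain ⟨a, ha⟩ := hne _ hXL'
      obtain ⟨b, hb⟩ := hne _ hYL'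
      have h2 : X ⊆ Y → Y ⊆ X := by
        intro hXY
        rcases hlam _ hYL' X hXL with h | h | h
        · exact absurd (hXY (Finset.mem_of_mem_erase ha)) (by grind [Finset.disjoint_left])
        · grind
        · exact absurd (h hxX) (Finset.notMem_erase x Y)
      have h3 : Y ⊆ X → X ⊆ Y := by
        intro hYX
        rcases hlam _ hXL' Y hYL with h | h | h
        · exact absurd (hYX (Finset.mem_of_mem_erase hb)) (by grind [Finset.disjoint_left])
        · grind
        · exact absurd (h hxY) (Finset.notMem_erase x X)
      rcases hlam X hXL Y hYL with h | h | h
      · exact absurd hxY (Finset.disjoint_left.1 h hxX)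
      · exact h.antisymm (h2 h)
      · exact (h3 h).antisymm h
    have h2 : (L₀ \ M).card ≤ ((L₀ \ M).image fun X => X.erase x).card := by
      refine (Finset.card_image_of_injOn fun X hX Y hY hXY => ?_).ge
      simp only [hM, Finset.coe_sdiff, Set.mem_sdiff, Finset.mem_coe, Finset.mem_filter,
        not_and] at hX hY
      change X.erase x = Y.erase x at hXY
      by_cases hxX : x ∈ X <;> by_cases hxY : x ∈ Y
      · rw [← Finset.insert_erase hxX, hXY, Finset.insert_erase hxY]
      · rw [Finset.erase_eq_of_notMem hxY] at hXY
        exact absurd (hXY ▸ hY.1) (hX.2 hX.1 hxX)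
      · rw [Finset.erase_eq_of_notMem hxX] at hXY
        exact absurd (hXY ▸ hX.1) (hY.2 hY.1 hxY)
      · rwa [Finset.erase_eq_of_notMem hxX, Finset.erase_eq_of_notMem hxY] at hXY
    have h3 := ih ((L₀ \ M).image fun X => X.erase x) ?_ ?_ ?_
    · have := Finset.card_le_card_sdiff_add_card (s := L₀) (t := M)
      rw [Finset.card_insert_of_notMem hx]
      omega
    all_goals simp only [Finset.forall_mem_image]
    · intro X hX
      have := hsub X (Finset.mem_of_mem_erase (Finset.mem_sdiff.1 hX).1)
      grind
    · intro X hX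
      obtain ⟨hX1, hX2⟩ := Finset.mem_erase.1 (Finset.mem_sdiff.1 hX).1
      rw [Finset.nonempty_iff_ne_empty, Ne, Finset.erase_eq_empty_iff]
      exact fun h => h.elim (hne X hX2).ne_empty hX1
    · intro X hX Y hY
      have := hlam X (Finset.mem_of_mem_erase (Finset.mem_sdiff.1 hX).1) Y
        (Finset.mem_of_mem_erase (Finset.mem_sdiff.1 hY).1)
      simp only [Finset.disjoint_left, Finset.subset_iff, Finset.mem_erase] at *
      grind

/-! ### Split systems -/

/-- A family of bipartitions `σ e` of `V`, each given by one of its sides, is a split system if no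
two of them cross: for all `e`, `e'` one of the four intersections of a side of `σ e` with a side of
`σ e'` is empty. -/
def IsSplitSystem {V α : Type*} (σ : α → V → Prop) : Prop :=
  ∀ e e', ∃ a b : Prop, ∀ x, ¬ ((σ e x ↔ a) ∧ (σ e' x ↔ b))

/-- Two points lie in the same part of `S` if they are separated by no or by all members of `S`. If
`S` consists of edges of a tree on the fundamental cycle of an edge `f`, then the parts are the
components that remain after adding `f` and removing `S`. -/
def SamePart {V α : Type*} (σ : α → V → Prop) (S : Finset α) (x y : V) : Prop :=
  (∀ e ∈ S, (σ e x ↔ σ e y)) ∨ ∀ e ∈ S, ¬ (σ e x ↔ σ e y)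

open Classical in
/-- The edges of `F` whose ends lie on different sides of `σ e`. -/
noncomputable def cut {V α : Type*} (σ : α → V → Prop) (F : Finset (Sym2 V)) (e : α) :
    Finset (Sym2 V) :=
  F.filter fun f => ∃ u ∈ f, ∃ v ∈ f, ¬ (σ e u ↔ σ e v)

section Split

variable {V α : Type*} {σ : α → V → Prop} {S S' : Finset α} {F : Finset (Sym2 V)}

theorem mk_mem_cut {e : α} {u v : V} :
    s(u, v) ∈ cut σ F e ↔ s(u, v) ∈ F ∧ ¬ (σ e u ↔ σ e v) := by
  simp only [cut, Finset.mem_filter, Sym2.mem_iff]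
  grind

theorem SamePart.symm {x y : V} (h : SamePart σ S x y) : SamePart σ S y x := by
  unfold SamePart at *
  grind

theorem SamePart.trans {x y z : V} (h : SamePart σ S x y) (h' : SamePart σ S y z) :
    SamePart σ S x z := by
  unfold SamePart at *
  grind

theorem SamePart.mono {x y : V} (h : SamePart σ S x y) (hS : S' ⊆ S) : SamePart σ S' x y :=
  h.imp (fun h e he => h e (hS he)) fun h e he => h e (hS he)

/-- Two pairs of points that are both separated by `e` and by `e'` are separated in the same
direction, as otherwise they would occupy all four intersections of sides. -/
theorem IsSplitSystem.aligned (hσ : IsSplitSystem σ) {e e' : α} {u v x y : V}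
    (hu : ¬ (σ e u ↔ σ e v)) (hu' : ¬ (σ e' u ↔ σ e' v))
    (hx : ¬ (σ e x ↔ σ e y)) (hx' : ¬ (σ e' x ↔ σ e' y)) :
    (σ e u ↔ σ e x) ↔ (σ e' u ↔ σ e' x) := by
  obtain ⟨a, b, hab⟩ := hσ e e'
  have := hab x; have := hab y; have := hab u; have := hab v
  clear hab hσ
  grind

theorem IsSplitSystem.agree_or_differ (hσ : IsSplitSystem σ) {u v x y : V}
    (huv : ∀ e ∈ S, ¬ (σ e u ↔ σ e v)) (hxy : ∀ e ∈ S, ¬ (σ e x ↔ σ e y)) :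
    (∀ e ∈ S, (σ e u ↔ σ e x) ∧ (σ e v ↔ σ e y)) ∨
      ∀ e ∈ S, (σ e u ↔ σ e y) ∧ (σ e v ↔ σ e x) := by
  by_contra h
  simp only [not_or, not_forall] at h
  obtain ⟨⟨e, he, h1⟩, e', he', h2⟩ := h
  have := hσ.aligned (huv e he) (huv e' he') (hxy e he) (hxy e' he')
  have := huv e he; have := huv e' he'; have := hxy e he; have := hxy e' he'
  clear huv hxy hσ
  grind

open Classical in
/-- Split `S` into the members that separate `x` and `y` and the others. If some edge is crossed by
all of `S`, then every point is in the part of `x` for one of the two halves: the halves are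
complementary arcs of a cycle. -/
theorem IsSplitSystem.samePart_or_samePart (hσ : IsSplitSystem σ) {u v : V}
    (huv : ∀ e ∈ S, ¬ (σ e u ↔ σ e v)) (x y k : V) :
    SamePart σ (S.filter fun e => ¬ (σ e x ↔ σ e y)) k x ∨
      SamePart σ (S.filter fun e => (σ e x ↔ σ e y)) k x := by
  by_contra h
  simp only [SamePart, Finset.mem_filter, not_or, not_forall] at h
  obtain ⟨⟨⟨e₁, ⟨he₁, h1⟩, h1'⟩, e₂, ⟨he₂, h2⟩, h2'⟩, ⟨e₃, ⟨he₃, h3⟩, h3'⟩, -⟩ := h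
  have l1 := huv e₁ he₁; have l2 := huv e₂ he₂; have l3 := huv e₃ he₃
  have m1 := hσ.aligned l1 l2 h1 h2
  have m2 := hσ.aligned l1 l3 (x := x) (y := k) (by grind) (by grind)
  have m3 := hσ.aligned l2 l3 (x := y) (y := k) (by grind) (by grind)
  clear huv hσ
  grind

/-- All parts of `S'` but that of `u` lie in the same part of `S`. -/
theorem IsSplitSystem.samePart_of_not_samePart (hσ : IsSplitSystem σ) {u v u' v' z z' : V}
    (hu : ∀ e ∈ S, ¬ (σ e u ↔ σ e v)) (hu' : ∀ e ∈ S', (σ e u ↔ σ e v))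
    (hv : SamePart σ S u' v') (hv' : ∀ e ∈ S', ¬ (σ e u' ↔ σ e v'))
    (hz : ¬ SamePart σ S' z u) (hz' : ¬ SamePart σ S' z' u) : SamePart σ S z z' := by
  -- Points separated from `u` by a common member of `S'` are not separated by `S`.
  have key : ∀ e' ∈ S', ∀ p q, ¬ (σ e' p ↔ σ e' u) → ¬ (σ e' q ↔ σ e' u) →
      ∀ e ∈ S, (σ e p ↔ σ e q) := by
    intro e' he' p q hp hq e he
    obtain ⟨a, b, hab⟩ := hσ e e'
    have := hab p; have := hab q; have := hab u; have := hab v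
    have := hu e he; have := hu' e' he'
    clear hab hu hu' hv hv' hz hz' hσ
    grind
  simp only [SamePart, not_or, not_forall] at hz hz'
  obtain ⟨⟨e, he, h⟩, -⟩ := hz
  obtain ⟨⟨e', he', h'⟩, -⟩ := hz'
  have i1 := hv' e he
  have i2 := hv' e' he'
  by_cases h1 : σ e u' ↔ σ e u <;> by_cases h2 : σ e' u' ↔ σ e' u
  · exact .inl fun i hi => (key e he z v' h (by tauto) i hi).trans
      (key e' he' v' z' (by tauto) h' i hi)
  · exact SamePart.trans (.inl (key e he z v' h (by tauto))) (hv.symm.trans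
      (.inl (key e' he' u' z' h2 h')))
  · exact SamePart.trans (.inl (key e he z u' h h1)) (hv.trans
      (.inl (key e' he' v' z' (by tauto) h')))
  · exact .inl fun i hi => (key e he z u' h h1 i hi).trans
      (key e' he' u' z' h2 h' i hi)

end Split

/-! ### Counting cuts and assigning them to edges -/

/-- Different cuts come from different sides, restricted to the ends of the edges involved and
oriented away from a fixed point; these restricted sides are laminar. -/
theorem card_cuts_le {V α : Type*} [DecidableEq V] {σ : α → V → Prop} (hσ : IsSplitSystem σ)
    (F : Finset (Sym2 V)) (X : Finset (Finset (Sym2 V)))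
    (hX : ∀ D ∈ X, D.Nonempty ∧ ∃ e, cut σ F e = D) : X.card ≤ 4 * (X.biUnion id).card := by
  classical
  rcases X.eq_empty_or_nonempty with rfl | ⟨D₀, hD₀⟩
  · simp
  obtain ⟨f₀, hf₀⟩ := (hX D₀ hD₀).1
  obtain ⟨r, hr⟩ : ∃ r, r ∈ f₀ := ⟨_, f₀.out_fst_mem⟩
  have : ∀ D, ∃ e, D ∈ X → cut σ F e = D := fun D => by
    obtain ⟨e₀, -⟩ := (hX D₀ hD₀).2
    by_cases hD : D ∈ X
    · exact (hX D hD).2.imp fun e he _ => he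
    · exact ⟨e₀, fun h => absurd h hD⟩
  choose e he using this
  set N := X.biUnion id with hN
  set R := N.biUnion Sym2.toFinset with hR
  have hRcard : R.card ≤ N.card * 2 := by
    refine Finset.card_biUnion_le_card_mul _ _ _ fun f _ => ?_
    rw [Sym2.card_toFinset]
    split <;> omega
  have hmemR : ∀ D ∈ X, ∀ f ∈ D, ∀ x ∈ f, x ∈ R := fun D hD f hf x hx =>
    Finset.mem_biUnion.2 ⟨f, Finset.mem_biUnion.2 ⟨D, hD, hf⟩, Sym2.mem_toFinset.2 hx⟩
  -- The ends of the edges in `N` that `e D` separates from `r`.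
  set side : Finset (Sym2 V) → Finset V :=
    fun D => R.filter fun x => ¬ (σ (e D) x ↔ σ (e D) r) with hside
  have hcut : ∀ D ∈ X, ∀ u v, s(u, v) ∈ N → (s(u, v) ∈ D ↔ ¬ (u ∈ side D ↔ v ∈ side D)) := by
    intro D hD u v huv
    obtain ⟨D', hD', huv'⟩ := Finset.mem_biUnion.1 huv
    have hF : s(u, v) ∈ F := (mk_mem_cut.1 ((he D' hD').symm ▸ huv')).1
    have hu := hmemR D' hD' _ huv' u (Sym2.mem_mk_left u v)
    have hv := hmemR D' hD' _ huv' v (Sym2.mem_mk_right u v)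
    have h1 : s(u, v) ∈ D ↔ ¬ (σ (e D) u ↔ σ (e D) v) := by
      conv_lhs => rw [← he D hD]
      rw [mk_mem_cut]
      exact and_iff_right hF
    simp only [hside, Finset.mem_filter, h1, hu, hv, true_and]
    grind
  have hinj : Set.InjOn side X := by
    intro D hD D' hD' h
    ext f
    induction f with
    | h u v =>
      constructor
      · intro hf
        have hfN : s(u, v) ∈ N := Finset.mem_biUnion.2 ⟨D, hD, hf⟩
        rwa [hcut D' hD' u v hfN, ← h, ← hcut D hD u v hfN]
      · intro hf
        have hfN : s(u, v) ∈ N := Finset.mem_biUnion.2 ⟨D', hD', hf⟩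
        rwa [hcut D hD u v hfN, h, ← hcut D' hD' u v hfN]
  have hlam := card_le_two_mul_of_laminar R (X.image side) ?_ ?_ ?_
  · rw [Finset.card_image_of_injOn hinj] at hlam
    omega
  all_goals simp only [Finset.forall_mem_image]
  · exact fun D _ => Finset.filter_subset _ _
  · intro D hD
    obtain ⟨f, hf⟩ := (hX D hD).1
    induction f with
    | h u v =>
      have := (hcut D hD u v (Finset.mem_biUnion.2 ⟨D, hD, hf⟩)).1 hf
      by_cases hu : u ∈ side D
      · exact ⟨u, hu⟩
      · exact ⟨v, by tauto⟩
  · -- The point `r` occupies the fourth intersection of sides.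
    intro D _ D' _
    obtain ⟨a, b, hab⟩ := hσ (e D) (e D')
    have h0 := hab r
    by_cases ha : a ↔ σ (e D) r
    · right; right
      intro x hx
      have h1 := hab x
      simp only [hside, Finset.mem_filter] at hx ⊢
      grind
    · by_cases hb : b ↔ σ (e D') r
      · right; left
        intro x hx
        have h1 := hab x
        simp only [hside, Finset.mem_filter] at hx ⊢
        grind
      · left
        rw [Finset.disjoint_left]
        intro x hx hx'
        have h1 := hab x
        simp only [hside, Finset.mem_filter] at hx hx'
        grind

/-- Hall's theorem assigns to every cut one of its edges such that no edge is used more than four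
times. -/
theorem exists_assignment {V α : Type*} [DecidableEq V] {σ : α → V → Prop}
    (hσ : IsSplitSystem σ) (F : Finset (Sym2 V)) (X : Finset (Finset (Sym2 V)))
    (hX : ∀ D ∈ X, D.Nonempty ∧ ∃ e, cut σ F e = D) {c : Sym2 V → ℝ} (hc : ∀ f ∈ F, 0 ≤ c f) :
    ∃ g : X → Sym2 V, (∀ D : X, g D ∈ D.1) ∧ ∑ D, c (g D) ≤ 4 * ∑ f ∈ F, c f := by
  classical
  obtain ⟨h, hinj, hmem⟩ := (Finset.all_card_le_biUnion_card_iff_exists_injective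
    (fun D : X => D.1 ×ˢ (Finset.univ : Finset (Fin 4)))).1 (by
      intro Y
      have h1 := card_cuts_le hσ F (Y.map (Function.Embedding.subtype _)) (by
        intro D hD
        obtain ⟨D', -, rfl⟩ := Finset.mem_map.1 hD
        exact hX _ D'.2)
      have h2 : (Y.biUnion fun D : X => D.1 ×ˢ (Finset.univ : Finset (Fin 4))) =
          ((Y.map (Function.Embedding.subtype _)).biUnion id) ×ˢ Finset.univ := by
        ext x
        simp
      rw [h2, Finset.card_product, Finset.card_univ, Fintype.card_fin]
      rw [Finset.card_map] at h1
      omega)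
  have hm : ∀ D, (h D).1 ∈ D.1 := fun D => (Finset.mem_product.1 (hmem D)).1
  refine ⟨fun D => (h D).1, hm, ?_⟩
  have hF : ∀ D, (h D).1 ∈ F := fun D => by
    obtain ⟨e, he⟩ := (hX D.1 D.2).2
    have := hm D
    rw [← he] at this
    exact (Finset.mem_filter.1 this).1
  calc ∑ D, c (h D).1 = ∑ p ∈ Finset.univ.image h, c p.1 :=
        (Finset.sum_image (f := fun p : Sym2 V × Fin 4 => c p.1) hinj.injOn).symm
    _ ≤ ∑ p ∈ F ×ˢ (Finset.univ : Finset (Fin 4)), c p.1 := by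
        refine Finset.sum_le_sum_of_subset_of_nonneg ?_ fun p hp _ =>
          hc _ (Finset.mem_product.1 hp).1
        rw [Finset.image_subset_iff]
        exact fun D _ => Finset.mem_product.2 ⟨hF D, Finset.mem_univ _⟩
    _ = 4 * ∑ f ∈ F, c f := by
        rw [Finset.sum_product]
        simp [Finset.mul_sum]

/-! ### Leaders of the parts -/

section Leaders

variable {V α κ ρ : Type*} [Fintype κ] [LinearOrder ρ] {σ : α → V → Prop} {S S' : Finset α}
  {rk : κ → ρ} {pt : κ → V} {K₀ : κ}

open Classical in
/-- For blocks `K : κ`, located at the points `pt K` and ranked by `rk`: the blocks of maximal rank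
in their part of `S`. -/
noncomputable def leaders (σ : α → V → Prop) (rk : κ → ρ) (pt : κ → V) (S : Finset α) :
    Finset κ :=
  Finset.univ.filter fun K => ∀ K', SamePart σ S (pt K') (pt K) → rk K' ≤ rk K

open Classical in
/-- The leaders of the parts of `S`, except for the two of highest rank, `K₀` being the block of
highest rank overall. -/
noncomputable def losers (σ : α → V → Prop) (rk : κ → ρ) (pt : κ → V) (K₀ : κ) (S : Finset α) :
    Finset κ :=
  (leaders σ rk pt S).filter fun K =>
    K ≠ K₀ ∧ ∃ K₁ ∈ leaders σ rk pt S, K₁ ≠ K₀ ∧ rk K < rk K₁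

theorem mem_leaders {K : κ} : K ∈ leaders σ rk pt S ↔
    ∀ K', SamePart σ S (pt K') (pt K) → rk K' ≤ rk K := by
  simp [leaders]

theorem mem_losers {K : κ} : K ∈ losers σ rk pt K₀ S ↔ K ∈ leaders σ rk pt S ∧
    K ≠ K₀ ∧ ∃ K₁ ∈ leaders σ rk pt S, K₁ ≠ K₀ ∧ rk K < rk K₁ := by
  simp [losers]

theorem leaders_subset (hS : S' ⊆ S) : leaders σ rk pt S' ⊆ leaders σ rk pt S := fun _ hK =>
  mem_leaders.2 fun K' h => mem_leaders.1 hK K' (h.mono hS)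

theorem not_samePart_top (hrk : Function.Injective rk) (hK₀ : ∀ K, rk K ≤ rk K₀) {K : κ}
    (hK : K ∈ leaders σ rk pt S) (hne : K ≠ K₀) : ¬ SamePart σ S (pt K₀) (pt K) := fun h =>
  hne (hrk ((hK₀ K).antisymm (mem_leaders.1 hK K₀ h)))

/-- The asymmetric case of `disjoint_losers`, in which the ends `u`, `v` of some edge are separated
by all of `S` but by none of `S'`. -/
theorem disjoint_losers_of_mem (hσ : IsSplitSystem σ) (hrk : Function.Injective rk)
    (hK₀ : ∀ K, rk K ≤ rk K₀) {u v u' v' : V}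
    (hu : ∀ e ∈ S, ¬ (σ e u ↔ σ e v)) (hu' : ∀ e ∈ S', (σ e u ↔ σ e v))
    (hv : SamePart σ S u' v') (hv' : ∀ e ∈ S', ¬ (σ e u' ↔ σ e v')) :
    Disjoint (losers σ rk pt K₀ S) (losers σ rk pt K₀ S') := by
  rw [Finset.disjoint_left]
  intro K hK hK'
  rw [mem_losers] at hK hK'
  obtain ⟨hKS, hne, K₁, hK₁, hne₁, hlt₁⟩ := hK
  obtain ⟨hKS', -, K₂, hK₂, hne₂, hlt₂⟩ := hK'
  have key := fun z z' => hσ.samePart_of_not_samePart (z := z) (z' := z') hu hu' hv hv'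
  have h0 := not_samePart_top hrk hK₀ hKS hne
  have h0' := not_samePart_top hrk hK₀ hKS' hne
  by_cases hu0 : SamePart σ S' (pt K₀) u <;> by_cases huK : SamePart σ S' (pt K) u
  · exact h0' (hu0.trans huK.symm)
  · by_cases h : SamePart σ S' (pt K₂) u
    · exact not_samePart_top hrk hK₀ hK₂ hne₂ (hu0.trans h.symm)
    · exact hlt₂.not_ge (mem_leaders.1 hKS K₂ (key _ _ h huK))
  · by_cases h : SamePart σ S' (pt K₁) u
    · exact hlt₁.not_ge (mem_leaders.1 hKS' K₁ (h.trans huK.symm))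
    · exact not_samePart_top hrk hK₀ hK₁ hne₁ (key _ _ hu0 h)
  · exact h0 (key _ _ hu0 huK)

theorem samePart_of_forall_cut_eq {F D : Finset (Sym2 V)} (hS : ∀ e ∈ S, cut σ F e = D) {u v : V}
    (huv : s(u, v) ∈ F) : SamePart σ S u v := by
  by_cases h : s(u, v) ∈ D
  · exact .inr fun e he => (mk_mem_cut.1 (hS e he ▸ h)).2
  · exact .inl fun e he => by
      by_contra h'
      exact h (hS e he ▸ mk_mem_cut.2 ⟨huv, h'⟩)

/-- A block is a loser for at most one class of tree edges with equal cuts. The parts of two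
classes are nested or disjoint once the parts of `K₀` are discarded, and inside a nested part only
the best block can lead again. -/
theorem disjoint_losers (hσ : IsSplitSystem σ) (hrk : Function.Injective rk)
    (hK₀ : ∀ K, rk K ≤ rk K₀) {F D D' : Finset (Sym2 V)} (hS : ∀ e ∈ S, cut σ F e = D)
    (hS' : ∀ e ∈ S', cut σ F e = D') (hD : D.Nonempty) (hD' : D'.Nonempty) (hDF : D ⊆ F)
    (hDF' : D' ⊆ F) (hne : D ≠ D') :
    Disjoint (losers σ rk pt K₀ S) (losers σ rk pt K₀ S') := by
  wlog h : ∃ f ∈ D, f ∉ D' generalizing S S' D D'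
  · refine (this hS' hS hD' hD hDF' hDF hne.symm ?_).symm
    by_contra! h'
    push Not at h
    exact hne (Finset.Subset.antisymm h h')
  obtain ⟨f, hf, hf'⟩ := h
  obtain ⟨f', hf''⟩ := hD'
  induction f with
  | h u v =>
    induction f' with
    | h u' v' =>
      refine disjoint_losers_of_mem hσ hrk hK₀ (u := u) (v := v) (u' := u') (v' := v') ?_ ?_
        (samePart_of_forall_cut_eq hS (hDF' hf'')) ?_
      · exact fun e he => (mk_mem_cut.1 (hS e he ▸ hf)).2
      · intro e he
        by_contra h'
        exact hf' (hS' e he ▸ mk_mem_cut.2 ⟨hDF hf, h'⟩)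
      · exact fun e he => (mk_mem_cut.1 (hS' e he ▸ hf'')).2

/-- If removing any subset of `S` costs at least the change in the widths, then two removals pay for
`S`: those of the two arcs into which the parts of the two best leaders split it. -/
theorem sum_le_of_swaps (hσ : IsSplitSystem σ) (hrk : Function.Injective rk)
    (hK₀ : ∀ K, rk K ≤ rk K₀) {u v : V} (huv : ∀ e ∈ S, ¬ (σ e u ↔ σ e v)) {w : κ → ℝ}
    (hw : ∀ K, 0 ≤ w K) {d : α → ℝ} {c : ℝ} (hc : 0 ≤ c) [DecidableEq κ]
    (hswap : ∀ S₁ ⊆ S, ∑ e ∈ S₁, d e ≤ c + ∑ K ∈ (leaders σ rk pt S₁).erase K₀, w K) :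
    ∑ e ∈ S, d e ≤ 2 * c + ∑ K ∈ losers σ rk pt K₀ S, w K := by
  classical
  have hnn : 0 ≤ ∑ K ∈ losers σ rk pt K₀ S, w K := Finset.sum_nonneg fun K _ => hw K
  rcases ((leaders σ rk pt S).erase K₀).eq_empty_or_nonempty with hM | hM
  · have := hswap S subset_rfl
    rw [hM, Finset.sum_empty] at this
    linarith
  obtain ⟨K₁, hK₁, hmax⟩ := Finset.exists_max_image _ rk hM
  set S₁ := S.filter fun e => ¬ (σ e (pt K₀) ↔ σ e (pt K₁)) with hS₁
  set S₂ := S.filter fun e => (σ e (pt K₀) ↔ σ e (pt K₁)) with hS₂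
  have hsub : ∀ S' ⊆ S, SamePart σ S' (pt K₀) (pt K₁) →
      (leaders σ rk pt S').erase K₀ ⊆ losers σ rk pt K₀ S := by
    intro S' hS' h01 K hK
    obtain ⟨hne, hK⟩ := Finset.mem_erase.1 hK
    obtain ⟨hne₁, hK₁'⟩ := Finset.mem_erase.1 hK₁
    refine mem_losers.2 ⟨leaders_subset hS' hK, hne, K₁, hK₁', hne₁, ?_⟩
    refine lt_of_le_of_ne (hmax K (Finset.mem_erase.2 ⟨hne, leaders_subset hS' hK⟩)) fun h => ?_
    rw [hrk h] at hK
    exact not_samePart_top hrk hK₀ hK hne₁ h01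
  have h1 := hsub S₁ (Finset.filter_subset _ _)
    (.inr fun e he => (Finset.mem_filter.1 he).2)
  have h2 := hsub S₂ (Finset.filter_subset _ _)
    (.inl fun e he => (Finset.mem_filter.1 he).2)
  have hdisj : Disjoint ((leaders σ rk pt S₁).erase K₀) ((leaders σ rk pt S₂).erase K₀) := by
    rw [Finset.disjoint_left]
    intro K hK hK'
    obtain ⟨hne, hK⟩ := Finset.mem_erase.1 hK
    obtain ⟨-, hK'⟩ := Finset.mem_erase.1 hK'
    rcases hσ.samePart_or_samePart huv (pt K₀) (pt K₁) (pt K) with h | h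
    · exact not_samePart_top hrk hK₀ hK hne h.symm
    · exact not_samePart_top hrk hK₀ hK' hne h.symm
  have h3 : ∑ K ∈ (leaders σ rk pt S₁).erase K₀, w K + ∑ K ∈ (leaders σ rk pt S₂).erase K₀, w K ≤
      ∑ K ∈ losers σ rk pt K₀ S, w K := by
    rw [← Finset.sum_union hdisj]
    exact Finset.sum_le_sum_of_subset_of_nonneg (Finset.union_subset h1 h2) fun K _ _ => hw K
  have h4 : ∑ e ∈ S₂, d e + ∑ e ∈ S₁, d e = ∑ e ∈ S, d e :=
    Finset.sum_filter_add_sum_filter_not _ _ _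
  have h5 := hswap S₁ (Finset.filter_subset _ _)
  have h6 := hswap S₂ (Finset.filter_subset _ _)
  linarith

/-- The charging argument: if every class of tree edges with the same non-empty cut can be swapped,
in whole or in part, against each edge of that cut, then the tree edges with a non-empty cut cost
at most eight times as much as `F` plus the total weight of the blocks. -/
theorem sum_le_of_forall_swaps [DecidableEq V] [DecidableEq κ] (hσ : IsSplitSystem σ)
    (hrk : Function.Injective rk) (hK₀ : ∀ K, rk K ≤ rk K₀) {F : Finset (Sym2 V)} {A : Finset α}
    {w : κ → ℝ} (hw : ∀ K, 0 ≤ w K) {d : α → ℝ} {c : Sym2 V → ℝ} (hc : ∀ f ∈ F, 0 ≤ c f)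
    (hswap : ∀ f ∈ F, ∀ S ⊆ A, (∃ D, f ∈ D ∧ ∀ e ∈ S, cut σ F e = D) →
      ∑ e ∈ S, d e ≤ c f + ∑ K ∈ (leaders σ rk pt S).erase K₀, w K) :
    ∑ e ∈ A.filter (fun e => cut σ F e ≠ ∅), d e ≤ 8 * ∑ f ∈ F, c f + ∑ K, w K := by
  classical
  set B := A.filter (fun e => cut σ F e ≠ ∅) with hB
  set X := B.image (cut σ F) with hXdef
  have hX : ∀ D ∈ X, D.Nonempty ∧ ∃ e, cut σ F e = D := by
    intro D hD
    obtain ⟨e, he, rfl⟩ := Finset.mem_image.1 hD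
    exact ⟨Finset.nonempty_iff_ne_empty.2 (Finset.mem_filter.1 he).2, e, rfl⟩
  have hXF : ∀ D ∈ X, D ⊆ F := by
    intro D hD
    obtain ⟨e, -, rfl⟩ := Finset.mem_image.1 hD
    exact Finset.filter_subset _ _
  obtain ⟨g, hg, hgsum⟩ := exists_assignment hσ F X hX hc
  set cls : X → Finset α := fun D => B.filter fun e => cut σ F e = D.1 with hcls
  have hcut : ∀ D, ∀ e ∈ cls D, cut σ F e = D.1 := fun D e he => (Finset.mem_filter.1 he).2
  have hclass : ∀ D : X, ∑ e ∈ cls D, d e ≤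
      2 * c (g D) + ∑ K ∈ losers σ rk pt K₀ (cls D), w K := by
    intro D
    have hgF := hXF _ D.2 (hg D)
    obtain ⟨u, v, huv⟩ : ∃ u v, g D = s(u, v) := by
      induction g D with | h u v => exact ⟨u, v, rfl⟩
    refine sum_le_of_swaps hσ hrk hK₀ (u := u) (v := v) (fun e he => ?_) hw (hc _ hgF)
      fun S₁ hS₁ => hswap _ hgF S₁ ?_ ⟨D.1, hg D, fun e he => hcut D e (hS₁ he)⟩
    · have := hg D
      rw [huv, ← hcut D e he] at this
      exact (mk_mem_cut.1 this).2
    · exact hS₁.trans ((Finset.filter_subset _ _).trans (Finset.filter_subset _ _))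
  have hlosers : ∑ D, ∑ K ∈ losers σ rk pt K₀ (cls D), w K ≤ ∑ K, w K := by
    rw [← Finset.sum_biUnion]
    · exact Finset.sum_le_sum_of_subset_of_nonneg (Finset.subset_univ _) fun K _ _ => hw K
    · intro D _ D' _ hne
      exact disjoint_losers hσ hrk hK₀ (hcut D) (hcut D') (hX _ D.2).1 (hX _ D'.2).1
        (hXF _ D.2) (hXF _ D'.2) (Subtype.coe_injective.ne hne)
  calc ∑ e ∈ B, d e = ∑ D ∈ X, ∑ e ∈ B.filter (fun e => cut σ F e = D), d e :=
        (Finset.sum_fiberwise_of_maps_to (fun e he => Finset.mem_image_of_mem _ he) _).symm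
    _ = ∑ D : X, ∑ e ∈ cls D, d e :=
        (Finset.sum_coe_sort X fun D => ∑ e ∈ B.filter (fun e => cut σ F e = D), d e).symm
    _ ≤ ∑ D : X, (2 * c (g D) + ∑ K ∈ losers σ rk pt K₀ (cls D), w K) :=
        Finset.sum_le_sum fun D _ => hclass D
    _ = 2 * ∑ D, c (g D) + ∑ D, ∑ K ∈ losers σ rk pt K₀ (cls D), w K := by
        rw [Finset.sum_add_distrib, Finset.mul_sum]
    _ ≤ 8 * ∑ f ∈ F, c f + ∑ K, w K := by linarith

end Leaders

/-! ### The sides of the edges of a tree -/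

section Tree

variable {V : Type*} {A F S : Finset (Sym2 V)} {G : SimpleGraph V} {T : Set (V × V)}

theorem mem_verts_left {u v : V} (h : s(u, v) ∈ A) : u ∈ verts A := ⟨_, h, Sym2.mem_mk_left u v⟩

theorem mem_verts_right {u v : V} (h : s(u, v) ∈ A) : v ∈ verts A := ⟨_, h, Sym2.mem_mk_right u v⟩

theorem mem_of_mem_edges {x y : V} (p : (graphOf A).Walk x y) {e : Sym2 V} (he : e ∈ p.edges) :
    e ∈ A := by
  have := p.edges_subset_edgeSet he
  rw [SimpleGraph.edgeSet_fromEdgeSet] at this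
  exact this.1

theorem reachable_of_edges_subset {B : Finset (Sym2 V)} {x y : V} (p : (graphOf A).Walk x y)
    (h : ∀ e ∈ p.edges, e ∈ B) : (graphOf B).Reachable x y := by
  refine ⟨p.transfer (graphOf B) fun e he => ?_⟩
  have := p.edges_subset_edgeSet he
  rw [SimpleGraph.edgeSet_fromEdgeSet] at this ⊢
  exact ⟨h e he, this.2⟩

theorem reachable_mono {B : Finset (Sym2 V)} (h : A ⊆ B) {x y : V}
    (hxy : (graphOf A).Reachable x y) : (graphOf B).Reachable x y :=
  hxy.mono (SimpleGraph.fromEdgeSet_mono (by exact_mod_cast h))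

theorem reachable_of_forall_mem {R : V → V → Prop} (hrefl : ∀ x, R x x)
    (htrans : ∀ x y z, R x y → R y z → R x z) (hF : ∀ u v, s(u, v) ∈ F → R u v) {x y : V}
    (h : (graphOf F).Reachable x y) : R x y := by
  obtain ⟨p⟩ := h
  induction p with
  | nil => exact hrefl _
  | cons h _ ih => exact htrans _ _ _ (hF _ _ ((SimpleGraph.fromEdgeSet_adj _).1 h).1) ih

theorem eq_of_reachable_of_notMem_verts {x y : V} (hx : x ∉ verts F)
    (h : (graphOf F).Reachable x y) : x = y := by
  obtain ⟨p⟩ := h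
  cases p with
  | nil => rfl
  | cons h _ => exact absurd (mem_verts_left ((SimpleGraph.fromEdgeSet_adj _).1 h).1) hx

variable [DecidableEq V]

theorem reachable_erase_of_notMem_edges {x y : V} (p : (graphOf A).Walk x y) {e : Sym2 V}
    (he : e ∉ p.edges) : (graphOf (A.erase e)).Reachable x y :=
  reachable_of_edges_subset p fun _ he' =>
    Finset.mem_erase.2 ⟨fun h => he (h ▸ he'), mem_of_mem_edges p he'⟩

theorem not_reachable_erase_of_mem_edges (hA : (graphOf A).IsAcyclic) {x y : V}
    (p : (graphOf A).Walk x y) (hp : p.IsPath) {e : Sym2 V} (he : e ∈ p.edges) :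
    ¬ (graphOf (A.erase e)).Reachable x y := by
  intro h
  obtain ⟨q, hq⟩ := h.exists_isPath
  have hle : graphOf (A.erase e) ≤ graphOf A :=
    SimpleGraph.fromEdgeSet_mono (by exact_mod_cast Finset.erase_subset _ _)
  have heq : p = q.mapLe hle :=
    congrArg Subtype.val ((hA.subsingleton_path x y).elim ⟨p, hp⟩ ⟨q.mapLe hle, hq.mapLe hle⟩)
  rw [heq, SimpleGraph.Walk.edges_mapLe_eq_edges] at he
  exact Finset.notMem_erase e A (mem_of_mem_edges q he)

theorem not_reachable_erase (hA : IsSteinerForest G T A) {a b : V} (h : s(a, b) ∈ A) :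
    ¬ (graphOf (A.erase s(a, b))).Reachable a b := by
  have hab : (graphOf A).Adj a b :=
    (SimpleGraph.fromEdgeSet_adj _).2 ⟨h, (hA.subset h : G.Adj a b).ne⟩
  refine not_reachable_erase_of_mem_edges hA.acyclic hab.toWalk ?_ ?_
  · simp [hab.ne]
  · simp

theorem reachable_erase_or {a b x : V} (h : (graphOf A).Reachable x a) :
    (graphOf (A.erase s(a, b))).Reachable x a ∨ (graphOf (A.erase s(a, b))).Reachable x b := by
  obtain ⟨p⟩ := h
  induction p with
  | nil => exact .inl .rfl
  | @cons x y a h _ ih =>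
    by_cases he : s(x, y) = s(a, b)
    · rcases Sym2.eq_iff.1 he with ⟨rfl, -⟩ | ⟨rfl, -⟩
      · exact .inl .rfl
      · exact .inr .rfl
    · obtain ⟨h1, h2⟩ := (SimpleGraph.fromEdgeSet_adj _).1 h
      have : (graphOf (A.erase s(a, b))).Adj x y :=
        (SimpleGraph.fromEdgeSet_adj _).2 ⟨Finset.mem_erase.2 ⟨he, h1⟩, h2⟩
      exact ih.imp this.reachable.trans this.reachable.trans

open Classical in
/-- The bipartition of the vertices by removing the edge `e` from the tree `A`. Vertices outside
`V[A]` are put on the side of `r`, which keeps the bipartitions from crossing. -/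
def side (A : Finset (Sym2 V)) (r : V) (e : Sym2 V) (x : V) : Prop :=
  e ∈ A ∧ (graphOf (A.erase e)).Reachable e.out.1 (if x ∈ verts A then x else r)

theorem exists_side_eq {r : V} (hr : r ∈ verts A) (x : V) :
    ∃ x' ∈ verts A, ∀ e, side A r e x ↔ side A r e x' := by
  by_cases hx : x ∈ verts A
  · exact ⟨x, hx, fun _ => Iff.rfl⟩
  · exact ⟨r, hr, fun e => by simp [side, hx, hr]⟩

theorem side_iff_side (hA : IsSteinerForest G T A) (hTree : IsTreeOn A) {r x y : V}
    {e : Sym2 V} (he : e ∈ A) (hx : x ∈ verts A) (hy : y ∈ verts A) :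
    (side A r e x ↔ side A r e y) ↔ (graphOf (A.erase e)).Reachable x y := by
  obtain ⟨a, b, hab, ha⟩ : ∃ a b, e = s(a, b) ∧ e.out.1 = a :=
    ⟨e.out.1, e.out.2, (Quot.out_eq e).symm, rfl⟩
  simp only [side, he, hx, hy, if_true, true_and, ha]
  subst hab
  have hav := mem_verts_left he
  have h0 := not_reachable_erase hA he
  have h1 := reachable_erase_or (b := b) (hTree.connected x hx a hav)
  have h2 := reachable_erase_or (b := b) (hTree.connected y hy a hav)
  constructor
  · intro h
    rcases h1 with h1 | h1
    · exact h1.trans (h.1 h1.symm)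
    · rcases h2 with h2 | h2
      · exact absurd ((h.2 h2.symm).trans h1) h0
      · exact h1.trans h2.symm
  · exact fun h => ⟨fun h' => h'.trans h, fun h' => h'.trans h.symm⟩

theorem isSplitSystem_side (hA : IsSteinerForest G T A) (hTree : IsTreeOn A) {r : V}
    (hr : r ∈ verts A) : IsSplitSystem (side A r) := by
  intro e e'
  by_cases he : e ∈ A
  swap
  · exact ⟨True, True, fun x h => he (h.1.2 trivial).1⟩
  by_cases he' : e' ∈ A
  swap
  · exact ⟨True, True, fun x h => he' (h.2.2 trivial).1⟩
  by_cases hee : e = e'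
  · subst hee
    exact ⟨True, False, fun x h => by simp_all⟩
  obtain ⟨a, b, hab⟩ : ∃ a b, e = s(a, b) := ⟨_, _, (Quot.out_eq e).symm⟩
  -- On the side of `e'` that does not contain `e`, all points are on the same side of `e`.
  have key : ∀ x ∈ verts A, ∀ y ∈ verts A, ¬ (side A r e' x ↔ side A r e' a) →
      (side A r e' x ↔ side A r e' y) → (side A r e x ↔ side A r e y) := by
    intro x hx y hy hxa hxy
    rw [side_iff_side hA hTree he' hx hy] at hxy
    obtain ⟨p⟩ := hxy
    have hav : a ∈ verts A := mem_verts_left (hab ▸ he)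
    rw [side_iff_side hA hTree he' hx hav] at hxa
    rw [side_iff_side hA hTree he hx hy]
    refine reachable_of_edges_subset p fun i hi => Finset.mem_erase.2 ⟨?_, ?_⟩
    · rintro rfl
      rw [hab] at hi
      exact hxa ⟨p.takeUntil a (p.fst_mem_support_of_mem_edges hi)⟩
    · exact Finset.mem_of_mem_erase (mem_of_mem_edges p hi)
  by_cases hp : ∃ p ∈ verts A, ¬ (side A r e' p ↔ side A r e' a)
  · obtain ⟨p, hp, hpa⟩ := hp
    refine ⟨¬ side A r e p, ¬ side A r e' a, fun x h => ?_⟩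
    obtain ⟨x', hx', hxx'⟩ := exists_side_eq hr x
    rw [hxx', hxx'] at h
    have := key x' hx' p hp
    tauto
  · push Not at hp
    refine ⟨True, ¬ side A r e' a, fun x h => ?_⟩
    obtain ⟨x', hx', hxx'⟩ := exists_side_eq hr x
    rw [hxx', hxx'] at h
    have := hp x' hx'
    tauto

theorem reachable_sdiff (hA : IsSteinerForest G T A) (hTree : IsTreeOn A) {r x y : V}
    (hx : x ∈ verts A) (hy : y ∈ verts A) (h : ∀ e ∈ S, (side A r e x ↔ side A r e y)) :
    (graphOf (A \ S)).Reachable x y := by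
  obtain ⟨p, hp⟩ := (hTree.connected x hx y hy).exists_isPath
  refine reachable_of_edges_subset p fun e he =>
    Finset.mem_sdiff.2 ⟨mem_of_mem_edges p he, fun heS => ?_⟩
  exact not_reachable_erase_of_mem_edges hA.acyclic p hp he
    ((side_iff_side hA hTree (mem_of_mem_edges p he) hx hy).1 (h e heS))

/-- Points in the same part of `S` are connected after adding an edge whose fundamental cycle
contains `S` and removing `S`. -/
theorem reachable_swap (hA : IsSteinerForest G T A) (hTree : IsTreeOn A) {r u v x y : V}
    (hr : r ∈ verts A) (hu : u ∈ verts A) (hv : v ∈ verts A) (huv : u ≠ v)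
    (hf : s(u, v) ∉ S) (hS : ∀ e ∈ S, ¬ (side A r e u ↔ side A r e v))
    (hx : x ∈ verts A) (hy : y ∈ verts A) (h : SamePart (side A r) S x y) :
    (graphOf (insert s(u, v) A \ S)).Reachable x y := by
  have hsub : A \ S ⊆ insert s(u, v) A \ S := Finset.sdiff_subset_sdiff (Finset.subset_insert _ _)
    subset_rfl
  have hadj : (graphOf (insert s(u, v) A \ S)).Reachable u v :=
    ((SimpleGraph.fromEdgeSet_adj _).2 ⟨by simp [hf], huv⟩ :
      (graphOf (insert s(u, v) A \ S)).Adj u v).reachable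
  have hcon := fun a b ha hb h => reachable_mono hsub
    (reachable_sdiff (S := S) (r := r) (x := a) (y := b) hA hTree ha hb h)
  rcases h with h | h
  · exact hcon x y hx hy h
  · rcases (isSplitSystem_side hA hTree hr).agree_or_differ h hS with h | h
    · exact (hcon x u hx hu fun e he => (h e he).1).trans
        (hadj.trans (hcon y v hy hv fun e he => (h e he).2).symm)
    · exact (hcon x v hx hv fun e he => (h e he).1).trans
        (hadj.symm.trans (hcon y u hy hu fun e he => (h e he).2).symm)

theorem graphOf_insert_sdiff_le {u v : V} :
    graphOf (insert s(u, v) A \ S) ≤ graphOf (A \ S) ⊔ SimpleGraph.edge u v := by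
  intro x y h
  rw [SimpleGraph.fromEdgeSet_adj] at h
  rw [SimpleGraph.sup_adj, SimpleGraph.fromEdgeSet_adj, SimpleGraph.edge_adj]
  have h1 : s(x, y) = s(u, v) ∨ s(x, y) ∈ A := by
    have := (Finset.mem_sdiff.1 (Finset.mem_coe.1 h.1)).1
    exact Finset.mem_insert.1 this
  have h2 := (Finset.mem_sdiff.1 (Finset.mem_coe.1 h.1)).2
  rcases h1 with h1 | h1
  · exact .inr ⟨Sym2.eq_iff.1 h1, h.2⟩
  · exact .inl ⟨Finset.mem_coe.2 (Finset.mem_sdiff.2 ⟨h1, h2⟩), h.2⟩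

/-- Removing edges of the fundamental cycle of `s(u, v)` along whose parts `F` never runs is an
edge/set swap. -/
theorem edgeSetSwap_of_samePart (hA : IsSteinerForest G T A) (hTree : IsTreeOn A)
    (hF : IsSteinerForest G T F) (hVerts : verts A = verts F) {r u v : V} (hr : r ∈ verts A)
    (hf : s(u, v) ∈ F) (hfA : s(u, v) ∉ A) (hSA : S ⊆ A) (hSne : S.Nonempty)
    (hS : ∀ e ∈ S, ¬ (side A r e u ↔ side A r e v))
    (hpure : ∀ x y, s(x, y) ∈ F → SamePart (side A r) S x y) :
    EdgeSetSwap G T F A (insert s(u, v) A \ S) := by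
  have hu : u ∈ verts A := hVerts ▸ mem_verts_left hf
  have hv : v ∈ verts A := hVerts ▸ mem_verts_right hf
  have huv : u ≠ v := (hF.subset hf : G.Adj u v).ne
  obtain ⟨p, hp⟩ := (hTree.connected v hv u hu).exists_isPath
  have hle : graphOf A ≤ graphOf (insert s(u, v) A) :=
    SimpleGraph.fromEdgeSet_mono (by exact_mod_cast Finset.subset_insert _ _)
  have hadj : (graphOf (insert s(u, v) A)).Adj u v :=
    (SimpleGraph.fromEdgeSet_adj _).2 ⟨by simp, huv⟩
  refine ⟨_, hf, S, hSA, u, .cons hadj (p.mapLe hle), ?_, ?_, rfl, ?_, ?_, ?_⟩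
  · refine (SimpleGraph.Walk.cons_isCycle_iff _ _).2 ⟨hp.mapLe hle, fun h => hfA ?_⟩
    rw [SimpleGraph.Walk.edges_mapLe_eq_edges] at h
    exact mem_of_mem_edges p h
  · intro e he
    rw [SimpleGraph.Walk.edges_cons, SimpleGraph.Walk.edges_mapLe_eq_edges]
    refine List.mem_cons_of_mem _ ?_
    by_contra h
    exact hS e he ((side_iff_side hA hTree (hSA he) hu hv).2
      (reachable_erase_of_notMem_edges p h).symm)
  · intro e he
    have := (Finset.mem_sdiff.1 (Finset.mem_coe.1 he)).1
    rcases Finset.mem_insert.1 this with rfl | h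
    · exact hF.subset hf
    · exact hA.subset h
  · refine SimpleGraph.IsAcyclic.anti graphOf_insert_sdiff_le ?_
    obtain ⟨e, he⟩ := hSne
    refine SimpleGraph.IsAcyclic.sup_edge_of_not_reachable (fun h => hS e he ?_)
      (hA.acyclic.anti (SimpleGraph.fromEdgeSet_mono (by exact_mod_cast Finset.sdiff_subset)))
    rw [side_iff_side hA hTree (hSA he) hu hv]
    refine reachable_mono (fun i hi => ?_) h
    obtain ⟨h1, h2⟩ := Finset.mem_sdiff.1 hi
    exact Finset.mem_erase.2 ⟨fun h => h2 (h ▸ he), h1⟩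
  · intro q hq
    refine reachable_of_forall_mem (fun x => .rfl) (fun x y z => .trans) (fun x y hxy => ?_)
      (hF.feasible q hq)
    exact reachable_swap hA hTree hr hu hv huv (fun h => hfA (hSA h)) hS
      (hVerts ▸ mem_verts_left hxy) (hVerts ▸ mem_verts_right hxy) (hpure x y hxy)

end Tree

/-! ### Distances and widths -/

section Width

variable {V : Type*} {A F S : Finset (Sym2 V)} {G : SimpleGraph V} {T : Set (V × V)}
  {d : Sym2 V → ℝ}

theorem pathDist_nonneg (hd : ∀ e ∈ G.edgeSet, 0 ≤ d e) (u v : V) : 0 ≤ pathDist G d u v := by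
  refine Real.sInf_nonneg ?_
  rintro _ ⟨p, -, rfl⟩
  refine List.sum_nonneg fun x hx => ?_
  obtain ⟨e, he, rfl⟩ := List.mem_map.1 hx
  exact hd e (p.edges_subset_edgeSet he)

theorem pathDist_le (hd : ∀ e ∈ G.edgeSet, 0 ≤ d e) {u v : V} (p : G.Walk u v) (hp : p.IsPath) :
    pathDist G d u v ≤ (p.edges.map d).sum := by
  refine csInf_le ⟨0, ?_⟩ ⟨p, hp, rfl⟩
  rintro _ ⟨p, -, rfl⟩
  refine List.sum_nonneg fun x hx => ?_
  obtain ⟨e, he, rfl⟩ := List.mem_map.1 hx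
  exact hd e (p.edges_subset_edgeSet he)

theorem width_nonneg (hd : ∀ e ∈ G.edgeSet, 0 ≤ d e) (W : Set V) : 0 ≤ width G d T W := by
  refine Real.sSup_nonneg ?_
  rintro _ ⟨p, -, -, -, rfl⟩
  exact pathDist_nonneg hd _ _

theorem width_le {W : Set V} {c : ℝ} (hc : 0 ≤ c)
    (h : ∀ p ∈ T, p.1 ∈ W → p.2 ∈ W → pathDist G d p.1 p.2 ≤ c) : width G d T W ≤ c := by
  refine Real.sSup_le ?_ hc
  rintro _ ⟨p, hp, h1, h2, rfl⟩
  exact h p hp h1 h2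

theorem pathDist_le_width [Finite V] {W : Set V} {p : V × V} (hp : p ∈ T) (h1 : p.1 ∈ W)
    (h2 : p.2 ∈ W) : pathDist G d p.1 p.2 ≤ width G d T W := by
  refine le_csSup ?_ ⟨p, hp, h1, h2, rfl⟩
  refine ((Set.toFinite T).image fun p => pathDist G d p.1 p.2).bddAbove.mono ?_
  rintro _ ⟨p, hp, -, -, rfl⟩
  exact ⟨p, hp, rfl⟩

/-- Isolated vertices have width `0`. -/
theorem mem_verts_of_width_pos (hd : ∀ e ∈ G.edgeSet, 0 ≤ d e)
    {K : (graphOf F).ConnectedComponent} (h : 0 < width G d T K.supp) : K.out ∈ verts F := by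
  by_contra hK
  refine h.not_ge (width_le le_rfl fun p _ h1 h2 => ?_)
  have key : ∀ x ∈ K.supp, K.out = x := fun x hx =>
    eq_of_reachable_of_notMem_verts hK (SimpleGraph.ConnectedComponent.exact
      ((Quot.out_eq K).trans (SimpleGraph.ConnectedComponent.mem_supp_iff _ _ |>.1 hx).symm))
  obtain ⟨x, y⟩ := p
  obtain rfl : x = y := (key x h1).symm.trans (key y h2)
  simpa using pathDist_le hd (SimpleGraph.Walk.nil : G.Walk x x) .nil

theorem totalWidth_nonneg (hd : ∀ e ∈ G.edgeSet, 0 ≤ d e) : 0 ≤ totalWidth G d T F :=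
  finsum_nonneg fun _ => width_nonneg hd _

theorem totalWidth_eq_sum [Fintype (graphOf F).ConnectedComponent] :
    totalWidth G d T F = ∑ K : (graphOf F).ConnectedComponent, width G d T K.supp :=
  finsum_eq_sum_of_fintype _

theorem totalWidth_le_cost [Finite V] (hd : ∀ e ∈ G.edgeSet, 0 ≤ d e)
    (hF : IsSteinerForest G T F) : totalWidth G d T F ≤ cost d F := by
  classical
  have := Fintype.ofFinite (graphOf F).ConnectedComponent
  rw [totalWidth_eq_sum]
  have hdF : ∀ e ∈ F, 0 ≤ d e := fun e he => hd e (hF.subset he)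
  set E : (graphOf F).ConnectedComponent → Finset (Sym2 V) :=
    fun K => F.filter fun e => ∀ x ∈ e, x ∈ K.supp with hE
  have hle : graphOf F ≤ G := by
    rw [SimpleGraph.fromEdgeSet_le]
    exact Set.sdiff_subset.trans hF.subset
  have h1 : ∀ K, width G d T K.supp ≤ ∑ e ∈ E K, d e := by
    intro K
    refine width_le (Finset.sum_nonneg fun e he => hdF e (Finset.mem_filter.1 he).1)
      fun q hq hq1 _ => ?_
    obtain ⟨p, hp⟩ := (hF.feasible q hq).exists_isPath
    have hnd : p.edges.Nodup := hp.isTrail.edges_nodup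
    calc pathDist G d q.1 q.2 ≤ ((p.mapLe hle).edges.map d).sum := pathDist_le hd _ (hp.mapLe hle)
      _ = ∑ e ∈ p.edges.toFinset, d e := by
          rw [SimpleGraph.Walk.edges_mapLe_eq_edges, List.sum_toFinset _ hnd]
      _ ≤ ∑ e ∈ E K, d e := by
          refine Finset.sum_le_sum_of_subset_of_nonneg (fun e he => ?_)
            fun e he _ => hdF e (Finset.mem_filter.1 he).1
          rw [List.mem_toFinset] at he
          refine Finset.mem_filter.2 ⟨mem_of_mem_edges p he, fun x hx => ?_⟩
          have hxp := p.mem_support_of_mem_edges he hx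
          rw [SimpleGraph.ConnectedComponent.mem_supp_iff] at hq1 ⊢
          rw [← hq1]
          exact SimpleGraph.ConnectedComponent.sound ⟨(p.takeUntil x hxp).reverse⟩
  refine (Finset.sum_le_sum fun K _ => h1 K).trans ?_
  rw [← Finset.sum_biUnion]
  · exact Finset.sum_le_sum_of_subset_of_nonneg
      (Finset.biUnion_subset.2 fun K _ => Finset.filter_subset _ _) fun e he _ => hdF e he
  · intro K _ K' _ hne
    refine Finset.disjoint_left.2 fun e he he' => hne ?_
    have h2 := (Finset.mem_filter.1 he).2 _ e.out_fst_mem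
    have h3 := (Finset.mem_filter.1 he').2 _ e.out_fst_mem
    rw [SimpleGraph.ConnectedComponent.mem_supp_iff] at h2 h3
    exact h2.symm.trans h3

/-- The connected components of `F` ranked by their width, with ties broken arbitrarily. -/
noncomputable def rank [Finite V] (G : SimpleGraph V) (d : Sym2 V → ℝ) (T : Set (V × V))
    (F : Finset (Sym2 V)) (K : (graphOf F).ConnectedComponent) :
    ℝ ×ₗ Fin (Nat.card (graphOf F).ConnectedComponent) :=
  toLex (width G d T K.supp, Finite.equivFin _ K)

theorem rank_injective [Finite V] : Function.Injective (rank G d T F) := fun K K' h => by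
  have := congrArg (fun x => (ofLex x).2) h
  exact (Finite.equivFin _).injective this

theorem width_le_of_rank_le [Finite V] {K K' : (graphOf F).ConnectedComponent}
    (h : rank G d T F K ≤ rank G d T F K') : width G d T K.supp ≤ width G d T K'.supp := by
  rcases Prod.Lex.toLex_le_toLex.1 h with h | h
  · exact h.le
  · exact h.1.le

theorem width_le_totalWidth [Finite V] (hd : ∀ e ∈ G.edgeSet, 0 ≤ d e)
    (hFA : ∀ x y, (graphOf F).Reachable x y → (graphOf A).Reachable x y)
    (K : (graphOf F).ConnectedComponent) : width G d T K.supp ≤ totalWidth G d T A := by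
  classical
  have := Fintype.ofFinite (graphOf A).ConnectedComponent
  rw [totalWidth_eq_sum]
  have h1 : K.supp ⊆ ((graphOf A).connectedComponentMk K.out).supp := by
    intro x hx
    rw [SimpleGraph.ConnectedComponent.mem_supp_iff] at hx ⊢
    refine SimpleGraph.ConnectedComponent.sound (hFA _ _ (SimpleGraph.ConnectedComponent.exact ?_))
    rw [hx]
    exact (Quot.out_eq K).symm
  refine le_trans ?_ (Finset.single_le_sum (fun C _ => width_nonneg hd _)
    (Finset.mem_univ ((graphOf A).connectedComponentMk K.out)))
  exact width_le (width_nonneg hd _) fun p hp hp1 hp2 =>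
    pathDist_le_width hp (h1 hp1) (h1 hp2)

/-- If every part of `S` is connected in `B`, then the total width of `B` is at most that of the
leaders: the width of a component of `B` is the width of the best component of `F` inside. -/
theorem totalWidth_le_sum_leaders [Finite V] [Fintype (graphOf F).ConnectedComponent]
    (hd : ∀ e ∈ G.edgeSet, 0 ≤ d e) (hF : Feasible T F) {B : Finset (Sym2 V)}
    (hFB : ∀ x y, (graphOf F).Reachable x y → (graphOf B).Reachable x y)
    {α : Type*} {σ : α → V → Prop} {S : Finset α}
    (hS : ∀ x ∈ verts F, ∀ y ∈ verts F, SamePart σ S x y → (graphOf B).Reachable x y) :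
    totalWidth G d T B ≤ ∑ K ∈ leaders σ (rank G d T F) (fun K => K.out) S,
      width G d T K.supp := by
  classical
  have := Fintype.ofFinite (graphOf B).ConnectedComponent
  rw [totalWidth_eq_sum]
  set Λ := leaders σ (rank G d T F) (fun K => K.out) S with hΛ
  set comp : (graphOf F).ConnectedComponent → (graphOf B).ConnectedComponent :=
    fun K => (graphOf B).connectedComponentMk K.out with hcomp
  have hmk : ∀ x, comp ((graphOf F).connectedComponentMk x) = (graphOf B).connectedComponentMk x :=
    fun x => SimpleGraph.ConnectedComponent.sound (hFB _ _ (SimpleGraph.ConnectedComponent.exact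
      (Quot.out_eq ((graphOf F).connectedComponentMk x))))
  rw [← Finset.sum_fiberwise Λ comp]
  refine Finset.sum_le_sum fun C _ => ?_
  have hnn : ∀ K ∈ Λ.filter (fun K => comp K = C), 0 ≤ width G d T K.supp :=
    fun K _ => width_nonneg hd _
  obtain ⟨K, hK, hmax⟩ := Finset.exists_max_image
    (Finset.univ.filter fun K => comp K = C) (rank G d T F) (by
      induction C using SimpleGraph.ConnectedComponent.ind with
      | h v => exact ⟨(graphOf F).connectedComponentMk v, by simp [hmk]⟩)
  have hKC : comp K = C := (Finset.mem_filter.1 hK).2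
  have hCK : width G d T C.supp ≤ width G d T K.supp := by
    refine width_le (width_nonneg hd _) fun p hp hp1 _ => ?_
    rw [SimpleGraph.ConnectedComponent.mem_supp_iff] at hp1
    have h1 : pathDist G d p.1 p.2 ≤ width G d T ((graphOf F).connectedComponentMk p.1).supp :=
      pathDist_le_width hp rfl (SimpleGraph.ConnectedComponent.sound (hF p hp).symm)
    exact h1.trans (width_le_of_rank_le (hmax _ (by simp [hmk, hp1])))
  rcases (width_nonneg hd K.supp).eq_or_lt with h0 | h0
  · exact (hCK.trans_eq h0.symm).trans (Finset.sum_nonneg hnn)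
  have hKΛ : K ∈ Λ := by
    refine mem_leaders.2 fun K' hK' => ?_
    by_cases hv : K'.out ∈ verts F
    · refine hmax K' (Finset.mem_filter.2 ⟨Finset.mem_univ _, ?_⟩)
      rw [← hKC]
      exact SimpleGraph.ConnectedComponent.sound
        (hS _ hv _ (mem_verts_of_width_pos hd h0) hK')
    · by_contra hlt
      exact hv (mem_verts_of_width_pos hd (h0.trans_le (width_le_of_rank_le (not_le.1 hlt).le)))
  exact hCK.trans (Finset.single_le_sum hnn (Finset.mem_filter.2 ⟨hKΛ, hKC⟩))

end Width

/-! ### The locality gap -/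

section Main

variable {V : Type*} [DecidableEq V] {A F S : Finset (Sym2 V)} {G : SimpleGraph V}
  {T : Set (V × V)} {d : Sym2 V → ℝ}

/-- Comparing potentials before and after the swap bounds the length of the removed edges. -/
theorem cost_le_of_edgeSetSwapOptimal [Finite V] [Fintype (graphOf F).ConnectedComponent]
    [DecidableEq (graphOf F).ConnectedComponent]
    (hd : ∀ e ∈ G.edgeSet, 0 ≤ d e) (hA : IsSteinerForest G T A) (hF : IsSteinerForest G T F)
    (hVerts : verts A = verts F) (hTree : IsTreeOn A) (hopt : EdgeSetSwapOptimal G d T F A)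
    {r : V} (hr : r ∈ verts A) {K₀ : (graphOf F).ConnectedComponent}
    (hK₀ : ∀ K, rank G d T F K ≤ rank G d T F K₀) {f : Sym2 V} (hf : f ∈ F) (hSA : S ⊆ A)
    {D : Finset (Sym2 V)} (hfD : f ∈ D) (hS : ∀ e ∈ S, cut (side A r) F e = D) :
    ∑ e ∈ S, d e ≤ d f + ∑ K ∈ (leaders (side A r) (rank G d T F) (fun K => K.out) S).erase K₀,
      width G d T K.supp := by
  have hnn : 0 ≤ ∑ K ∈ (leaders (side A r) (rank G d T F) (fun K => K.out) S).erase K₀,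
      width G d T K.supp := Finset.sum_nonneg fun K _ => width_nonneg hd _
  have hdf := hd f (hF.subset hf)
  rcases S.eq_empty_or_nonempty with rfl | hSne
  · rw [Finset.sum_empty]
    linarith
  induction f with
  | h u v =>
  have hsep : ∀ e ∈ S, ¬ (side A r e u ↔ side A r e v) := fun e he =>
    (mk_mem_cut.1 (hS e he ▸ hfD)).2
  have hu : u ∈ verts A := hVerts ▸ mem_verts_left hf
  have hv : v ∈ verts A := hVerts ▸ mem_verts_right hf
  have huv : u ≠ v := (hF.subset hf : G.Adj u v).ne
  by_cases hfA : s(u, v) ∈ A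
  · -- An edge of `A` is crossed by no other edge of `A`.
    have hsub : S ⊆ {s(u, v)} := by
      intro e he
      rw [Finset.mem_singleton]
      by_contra hne
      refine hsep e he ((side_iff_side hA hTree (hSA he) hu hv).2 ?_)
      exact ((SimpleGraph.fromEdgeSet_adj _).2 ⟨by simp [hfA, Ne.symm hne], huv⟩ :
        (graphOf (A.erase e)).Adj u v).reachable
    have := Finset.sum_le_sum_of_subset_of_nonneg (f := d) hsub fun e he _ => by
      rwa [Finset.mem_singleton.1 he]
    rw [Finset.sum_singleton] at this
    linarith
  have hpure : ∀ x y, s(x, y) ∈ F → SamePart (side A r) S x y := fun x y hxy =>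
    samePart_of_forall_cut_eq hS hxy
  have hswap := hopt _ (edgeSetSwap_of_samePart hA hTree hF hVerts hr hf hfA hSA hSne hsep hpure)
  have hreach : ∀ x ∈ verts F, ∀ y ∈ verts F, SamePart (side A r) S x y →
      (graphOf (insert s(u, v) A \ S)).Reachable x y := fun x hx y hy h =>
    reachable_swap hA hTree hr hu hv huv (fun h => hfA (hSA h)) hsep (hVerts ▸ hx) (hVerts ▸ hy) h
  have hwB := totalWidth_le_sum_leaders hd hF.feasible (fun x y hxy =>
    reachable_of_forall_mem (fun x => .rfl) (fun x y z => .trans)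
      (fun x y hxy => hreach x (mem_verts_left hxy) y (mem_verts_right hxy) (hpure x y hxy)) hxy)
    hreach
  have hwA := width_le_totalWidth (T := T) hd (A := A) (fun x y hxy =>
    reachable_of_forall_mem (fun x => .rfl) (fun x y z => .trans)
      (fun x y hxy => hTree.connected x (hVerts ▸ mem_verts_left hxy) y
        (hVerts ▸ mem_verts_right hxy)) hxy) K₀
  have hmem : K₀ ∈ leaders (side A r) (rank G d T F) (fun K => K.out) S :=
    mem_leaders.2 fun K _ => hK₀ K
  have hsplit := Finset.add_sum_erase _ (fun K => width G d T K.supp) hmem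
  have hcost : cost d (insert s(u, v) A \ S) + ∑ e ∈ S, d e = d s(u, v) + cost d A := by
    unfold cost
    rw [Finset.sum_sdiff (hSA.trans (Finset.subset_insert _ _)), Finset.sum_insert hfA]
  unfold potential at hswap
  linarith

theorem inessential_of_cut_eq_empty (hA : IsSteinerForest G T A) (hF : IsSteinerForest G T F)
    (hVerts : verts A = verts F) (hTree : IsTreeOn A) {r : V} {e : Sym2 V} (he : e ∈ A)
    (hcut : cut (side A r) F e = ∅) : Inessential T A e := by
  intro p hp
  refine reachable_of_forall_mem (fun x => .rfl) (fun x y z => .trans) (fun x y hxy => ?_)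
    (hF.feasible p hp)
  rw [← side_iff_side hA hTree (r := r) he (hVerts ▸ mem_verts_left hxy)
    (hVerts ▸ mem_verts_right hxy)]
  by_contra h
  exact Finset.notMem_empty _ (hcut ▸ mk_mem_cut.2 ⟨hxy, h⟩)

theorem cost_dropInessential_le [Finite V] (hd : ∀ e ∈ G.edgeSet, 0 ≤ d e)
    (hA : IsSteinerForest G T A) (hF : IsSteinerForest G T F)
    (hVerts : verts A = verts F) (hTree : IsTreeOn A) (hopt : EdgeSetSwapOptimal G d T F A) :
    cost d (dropInessential T A) ≤ 8 * cost d F + totalWidth G d T F := by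
  classical
  have hdF : ∀ f ∈ F, 0 ≤ d f := fun f hf => hd f (hF.subset hf)
  have := Fintype.ofFinite (graphOf F).ConnectedComponent
  rcases A.eq_empty_or_nonempty with rfl | ⟨e₀, he₀⟩
  · have h1 : cost d (dropInessential T (∅ : Finset (Sym2 V))) = 0 := by
      simp [cost, dropInessential]
    have h2 : 0 ≤ cost d F := Finset.sum_nonneg hdF
    have h3 : 0 ≤ totalWidth G d T F := totalWidth_nonneg hd
    linarith
  obtain ⟨r, hr⟩ : ∃ r, r ∈ verts A := ⟨_, e₀, he₀, e₀.out_fst_mem⟩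
  obtain ⟨K₀, -, hK₀⟩ := Finset.exists_max_image Finset.univ (rank G d T F)
    ⟨(graphOf F).connectedComponentMk r, Finset.mem_univ _⟩
  have hswap : ∀ f ∈ F, ∀ S ⊆ A, (∃ D, f ∈ D ∧ ∀ e ∈ S, cut (side A r) F e = D) →
      ∑ e ∈ S, d e ≤ d f + ∑ K ∈ (leaders (side A r) (rank G d T F) (fun K => K.out) S).erase K₀,
        width G d T K.supp := fun f hf S hSA ⟨D, hfD, hS⟩ =>
    cost_le_of_edgeSetSwapOptimal hd hA hF hVerts hTree hopt hr
      (fun K => hK₀ K (Finset.mem_univ K)) hf hSA hfD hS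
  have key := sum_le_of_forall_swaps (isSplitSystem_side hA hTree hr) rank_injective
    (fun K => hK₀ K (Finset.mem_univ K)) (fun K => width_nonneg hd _) hdF hswap
  rw [totalWidth_eq_sum]
  refine le_trans (Finset.sum_le_sum_of_subset_of_nonneg ?_ fun e he _ => ?_) key
  · intro e he
    obtain ⟨heA, hess⟩ := Finset.mem_filter.1 he
    exact Finset.mem_filter.2 ⟨heA, fun h =>
      hess (inessential_of_cut_eq_empty hA hF hVerts hTree heA h)⟩
  · exact hd e (hA.subset (Finset.mem_filter.1 he).1)

end Main

end SteinerForest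

theorem mainTheorem4 {V : Type*} [Fintype V] [DecidableEq V] (G : SimpleGraph V)
    (d : Sym2 V → ℝ) (hd : ∀ e ∈ G.edgeSet, 0 ≤ d e) (T : Set (V × V))
    (A F : Finset (Sym2 V))
    (hA : SteinerForest.IsSteinerForest G T A) (hF : SteinerForest.IsSteinerForest G T F)
    (hVerts : SteinerForest.verts A = SteinerForest.verts F)
    (hTree : SteinerForest.IsTreeOn A)
    (hEdgeEdge : SteinerForest.EdgeEdgeSwapOptimal G d T F A)
    (hEdgeSet : SteinerForest.EdgeSetSwapOptimal G d T F A) :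
    SteinerForest.cost d (SteinerForest.dropInessential T A) ≤
        10.5 * SteinerForest.cost d F + SteinerForest.totalWidth G d T F ∧
      10.5 * SteinerForest.cost d F + SteinerForest.totalWidth G d T F ≤
        11.5 * SteinerForest.cost d F := by
  have h1 := SteinerForest.cost_dropInessential_le hd hA hF hVerts hTree hEdgeSet
  have h2 := SteinerForest.totalWidth_le_cost hd hF
  have h3 : 0 ≤ SteinerForest.cost d F := Finset.sum_nonneg fun f hf => hd f (hF.subset hf)
  constructor <;> linarith
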